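/- All groups are finite and all characters are complex. A character triple $(G,N,\phi)$ consists of a group $G$, a normal subgroup $N \lhd G$ and a $G$-invariant irreducible character $\phi \in \operatorname{Irr}(N)$. For $N \le H \le G$, let $\operatorname{Ch}(H\mid\phi)$ be the set of characters $\chi$ of $H$ whose restriction $\chi_N$ is a multiple of $\phi$. An isomorphism of character triples $(G,N,\phi)\to(\Gamma,A,\lambda)$ is a pair $(\tau,\sigma)$ where $\tau\colon G/N\to\Gamma/A$ is a group isomorphism and $\sigma$ is a family of maps $\sigma_H\colon \operatorname{Ch}(H\mid\phi)\to\operatorname{Ch}(H^\tau\mid\lambda)$, one for each $N\le H\le G$, where $H^\tau$ denotes the preimage in $\Gamma$ of $\tau(H/N)$, such that for all $N\le K\le H\le G$ and all $\chi,\psi\in\operatorname{Ch}(H\mid\phi)$: (a) $\sigma_H(\chi+\psi)=\sigma_H(\chi)+\sigma_H(\psi)$; (b) $[\sigma_H(\chi),\sigma_H(\psi)]=[\chi,\psi]$; (c) $\sigma_K(\chi_K)=(\sigma_H(\chi))_{K^\tau}$; (d) $\sigma_H(\chi\beta)=\sigma_H(\chi)\beta^\tau$ for every $\beta\in\operatorname{Irr}(H/N)$,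 where $\beta^\tau \in \operatorname{Irr}(H^\tau/A)$ corresponds to $\beta$ under $\tau$. The determinantal order $o(\chi)$ of a character $\chi$ is the order of the linear character $\det\chi$, where $\det \chi$ is the determinant of any representation affording $\chi$. **Proposition 2.1.** Let $(G,N,\phi)$ and $(\Gamma,A,\lambda)$ be isomorphic character triples, and suppose that $A\le\Gamma'$ (the commutator subgroup of $\Gamma$) and that $\lambda$ is linear, i.e. $\lambda(1)=1$. If $p$ is a prime number dividing $o(\lambda)$, then $p$ divides $\phi(1)\,o(\phi)$. -/

import Mathlib

open scoped ComplexConjugate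

noncomputable section

namespace CharTriple

section Characters

variable {G : Type*} [Group G]

/-- `χ` is an (ordinary, complex) character of `G`: the trace function of a complex
representation of finite positive degree. -/
def IsCharacter (χ : G → ℂ) : Prop :=
  ∃ (n : ℕ) (ρ : Representation ℂ G (Fin n → ℂ)), n ≠ 0 ∧ ρ.character = χ

/-- `χ ∈ Irr(G)`: the trace function of an irreducible complex representation of finite degree. -/
def IsIrrCharacter (χ : G → ℂ) : Prop :=
  ∃ (n : ℕ) (ρ : Representation ℂ G (Fin n → ℂ)), ρ.IsIrreducible ∧ ρ.character = χ

/-- The usual inner product `[χ, ψ] = |G|⁻¹ ∑ χ(g) conj(ψ(g))` of functions on a finite group. -/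
def charInner (χ ψ : G → ℂ) : ℂ :=
  (Nat.card G : ℂ)⁻¹ * ∑ᶠ g : G, χ g * conj (ψ g)

/-- The linear character `g ↦ det (ρ g)` of a representation `ρ`. -/
def repDet {V : Type*} [AddCommGroup V] [Module ℂ V] (ρ : Representation ℂ G V) : G →* ℂ :=
  (LinearMap.det : (V →ₗ[ℂ] V) →* ℂ).comp ρ

open Classical in
/-- The linear character `det χ` of an irreducible character `χ`: the determinant of an irreducible
representation affording `χ` (for finite `G` it does not depend on which one, see
`irrDet_eq_repDet`); the trivial character by convention if `χ` is not irreducible. -/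
def irrDet (χ : G → ℂ) : G →* ℂ :=
  if h : IsIrrCharacter χ then repDet h.choose_spec.choose else 1

/-- The determinantal order `o(χ)` of an irreducible character: the order of `det χ` under
pointwise multiplication. -/
def detOrder (χ : G → ℂ) : ℕ := orderOf (irrDet χ)

theorem repDet_eq_of_equiv {V W : Type*} [AddCommGroup V] [Module ℂ V] [AddCommGroup W]
    [Module ℂ W] {ρ : Representation ℂ G V} {σ : Representation ℂ G W}
    (e : Representation.Equiv ρ σ) : repDet ρ = repDet σ := by
  ext g
  have h := e.conj_apply_self g
  simp only [repDet, MonoidHom.comp_apply]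
  rw [← h]
  exact (LinearMap.det_conj (ρ g) e.toLinearEquiv).symm

/-- `det χ` may be computed from any irreducible representation affording `χ`. -/
theorem irrDet_eq_repDet [Finite G] {n : ℕ} (ρ : Representation ℂ G (Fin n → ℂ))
    (hρ : ρ.IsIrreducible) : irrDet ρ.character = repDet ρ := by
  classical
  have := Fintype.ofFinite G
  have h : IsIrrCharacter ρ.character := ⟨n, ρ, hρ, rfl⟩
  obtain ⟨h1, h2⟩ := h.choose_spec.choose_spec
  rw [irrDet, dif_pos h]
  generalize h.choose_spec.choose = σ at h1 h2
  have hG : (Nat.card G : ℂ) ≠ 0 := Nat.cast_ne_zero.2 Nat.card_pos.ne'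
  let _ : Invertible (Nat.card G : ℂ) := invertibleOfNonzero hG
  have a := Representation.char_orthonormal (G := G) (k := ℂ) σ ρ
  have b := Representation.char_orthonormal (G := G) (k := ℂ) ρ ρ
  rw [if_pos ⟨Representation.Equiv.refl ρ⟩] at b
  rw [h2, b] at a
  by_cases hne : Nonempty (Representation.Equiv ρ σ)
  · exact (repDet_eq_of_equiv hne.some).symm
  · rw [if_neg hne] at a
    exact absurd a one_ne_zero

end Characters

section Triples

variable {G Γ : Type*} [Group G] [Group Γ]

/-- `(G, N, φ)` is a character triple (`G` finite, `N` normal in `G`): `φ` is an irreducible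
character of `N` that is invariant under conjugation by `G`. -/
structure IsCharTriple (N : Subgroup G) [N.Normal] (φ : N → ℂ) : Prop where
  irr : IsIrrCharacter φ
  invariant : ∀ (g : G) (n : N), φ (MulAut.conjNormal g n) = φ n

/-- The restriction `χ_K` of a function on `H` to a subgroup `K ≤ H`. -/
def res {H K : Subgroup G} (hKH : K ≤ H) (χ : H → ℂ) : K → ℂ :=
  fun k => χ (Subgroup.inclusion hKH k)

/-- `Ch(H | φ)`, for `N ≤ H`: the characters of `H` whose restriction to `N` is a multiple
of `φ`. -/
def charsOver {N H : Subgroup G} (hNH : N ≤ H) (φ : N → ℂ) : Set (H → ℂ) :=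
  {χ | IsCharacter χ ∧ ∃ m : ℕ, res hNH χ = fun n => (m : ℂ) * φ n}

variable (N : Subgroup G) [N.Normal] (A : Subgroup Γ) [A.Normal]

/-- `H / N`, as a subgroup of `G / N`. -/
abbrev quot (H : Subgroup G) : Subgroup (G ⧸ N) := H.map (QuotientGroup.mk' N)

variable {N A} (τ : G ⧸ N ≃* Γ ⧸ A)

/-- `H^τ`: the inverse image in `Γ` of `τ(H / N)`. -/
def transport (H : Subgroup G) : Subgroup Γ :=
  ((quot N H).map τ.toMonoidHom).comap (QuotientGroup.mk' A)

theorem transport_mono {H K : Subgroup G} (h : K ≤ H) : transport τ K ≤ transport τ H :=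
  Subgroup.comap_mono (Subgroup.map_mono (Subgroup.map_mono h))

theorem le_transport (H : Subgroup G) : A ≤ transport τ H := by
  intro x hx
  have h : QuotientGroup.mk' A x = 1 := (QuotientGroup.eq_one_iff x).2 hx
  rw [transport, Subgroup.mem_comap, h]
  exact one_mem _

theorem symm_mk_mem_quot {H : Subgroup G} {x : Γ} (hx : x ∈ transport τ H) :
    τ.symm (QuotientGroup.mk' A x) ∈ quot N H := by
  obtain ⟨y, hy, hyx⟩ := Subgroup.mem_map.1 (Subgroup.mem_comap.1 hx)
  rw [← hyx]
  simpa using hy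

/-- A function on `H / N`, viewed as a function on `H`. -/
def inflate {H : Subgroup G} (β : quot N H → ℂ) : H → ℂ :=
  fun h => β ⟨QuotientGroup.mk' N h, Subgroup.mem_map_of_mem _ h.2⟩

/-- For a function `β` on `H / N`, the function `β^τ` on `H^τ / A` corresponding to `β` under `τ`,
viewed as a function on `H^τ`. -/
def twist {H : Subgroup G} (β : quot N H → ℂ) : transport τ H → ℂ :=
  fun x => β ⟨τ.symm (QuotientGroup.mk' A (x : Γ)), symm_mk_mem_quot τ x.2⟩

/-- `(τ, σ)` is an isomorphism of character triples `(G, N, φ) → (Γ, A, lam)`. For every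
`N ≤ H ≤ G`, the map `σ_H : Ch(H | φ) → Ch(H^τ | lam)` is `σ H` (only the values of `σ H` on
`Ch(H | φ)` for `N ≤ H` matter). -/
structure IsCharTripleIso (φ : N → ℂ) (lam : A → ℂ) (τ : G ⧸ N ≃* Γ ⧸ A)
    (σ : ∀ H : Subgroup G, (H → ℂ) → (transport τ H → ℂ)) : Prop where
  mapsTo : ∀ (H : Subgroup G) (hNH : N ≤ H),
    Set.MapsTo (σ H) (charsOver hNH φ) (charsOver (le_transport τ H) lam)
  map_add : ∀ (H : Subgroup G) (hNH : N ≤ H), ∀ χ ∈ charsOver hNH φ, ∀ ψ ∈ charsOver hNH φ,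
    σ H (χ + ψ) = σ H χ + σ H ψ
  map_inner : ∀ (H : Subgroup G) (hNH : N ≤ H), ∀ χ ∈ charsOver hNH φ, ∀ ψ ∈ charsOver hNH φ,
    charInner (σ H χ) (σ H ψ) = charInner χ ψ
  map_res : ∀ (H K : Subgroup G) (hNK : N ≤ K) (hKH : K ≤ H), ∀ χ ∈ charsOver (hNK.trans hKH) φ,
    σ K (res hKH χ) = res (transport_mono τ hKH) (σ H χ)
  map_mul : ∀ (H : Subgroup G) (hNH : N ≤ H), ∀ χ ∈ charsOver hNH φ,
    ∀ β : quot N H → ℂ, IsIrrCharacter β → σ H (χ * inflate β) = σ H χ * twist τ β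

/-- The character triples `(G, N, φ)` and `(Γ, A, lam)` are isomorphic. -/
def CharTripleIsomorphic (φ : N → ℂ) (lam : A → ℂ) : Prop :=
  ∃ (τ : G ⧸ N ≃* Γ ⧸ A) (σ : ∀ H : Subgroup G, (H → ℂ) → (transport τ H → ℂ)),
    IsCharTripleIso φ lam τ σ

end Triples

end CharTriple

end

/-! Suppose `p` does not divide φ(1)o(φ). Then φ extends to a subgroup `H ≥ N` of index prime to `p`
(`exists_extension_of_coprime`), and the triple isomorphism turns this extension into a linear
character μ of `H^τ` extending λ (`IsCharTripleIso.res_map_eq`). As λ is Γ-invariant, the transfer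
of μ to Γ restricts to A as λ^|G:H| (`transfer_eq_pow_index`). The transfer has abelian target, so
it kills Γ' ≥ A. Hence o(λ) divides |G:H|, which is prime to `p`.

For the extension, the pairs (g, T) with T intertwining ρ and its g-conjugate and (det T)^o(φ) = 1
form a finite group E over G, with kernel consisting of scalars of order dividing φ(1)o(φ). Modulo
the copy M of N formed by the pairs (n, ρ n), this kernel is a p'-group, so the preimage of a Sylow
`p`-subgroup of E/M embeds in G; its second coordinate is the extended representation. -/

namespace CharTriple

/-! ### Orthogonality and Schur's lemma -/

section Characters

variable {G : Type*} [Group G]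

-- Averaging gives a positive definite G-invariant form P, for which each ρ g is unitary; so (ρ g)ᴴ
-- is similar to ρ g⁻¹. This reconciles `charInner` with orthogonality stated through g⁻¹.
open scoped Matrix ComplexOrder in
theorem conj_character [Finite G] {n : ℕ} (ρ : Representation ℂ G (Fin n → ℂ)) (g : G) :
    conj (ρ.character g) = ρ.character g⁻¹ := by
  classical
  have := Fintype.ofFinite G
  let M : G → Matrix (Fin n) (Fin n) ℂ := fun h => LinearMap.toMatrix' (ρ h)
  have hmul : ∀ a b, M (a * b) = M a * M b := fun a b => by
    simp [M, Module.End.mul_eq_comp, LinearMap.toMatrix'_comp]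
  have hone : M 1 = 1 := by simp [M, Module.End.one_eq_id]
  have htr : ∀ h, ρ.character h = (M h).trace := fun h => by
    rw [Representation.character, ← Matrix.trace_toLin'_eq, Matrix.toLin'_toMatrix']
  let P : Matrix (Fin n) (Fin n) ℂ := ∑ h, (M h)ᴴ * M h
  have hP : P.PosDef := by
    refine Matrix.posDef_sum Finset.univ_nonempty fun h _ => ?_
    refine Matrix.PosDef.conjTranspose_mul_self _ ?_
    refine Matrix.mulVec_injective_of_isUnit ?_
    exact IsUnit.of_mul_eq_one (M h⁻¹) (by rw [← hmul, mul_inv_cancel, hone])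
  have hinv : (M g)ᴴ * P * M g = P := by
    simp only [P, Finset.mul_sum, Finset.sum_mul]
    refine Fintype.sum_equiv (Equiv.mulRight g) _ _ fun h => ?_
    simp [hmul, Matrix.conjTranspose_mul, Matrix.mul_assoc]
  have hdet : IsUnit P.det := (Matrix.isUnit_iff_isUnit_det _).1 hP.isUnit
  have hgg : M g * M g⁻¹ = 1 := by rw [← hmul, mul_inv_cancel, hone]
  have key : (M g)ᴴ = P * M g⁻¹ * P⁻¹ := by
    have : (M g)ᴴ * P = P * M g⁻¹ := by
      calc (M g)ᴴ * P = (M g)ᴴ * P * (M g * M g⁻¹) := by rw [hgg, mul_one]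
        _ = P * M g⁻¹ := by rw [← mul_assoc, hinv]
    rw [← this, Matrix.mul_assoc, Matrix.mul_nonsing_inv _ hdet, mul_one]
  rw [htr, htr, starRingEnd_apply, ← Matrix.trace_conjTranspose, key, Matrix.trace_mul_comm,
    ← Matrix.mul_assoc, Matrix.nonsing_inv_mul _ hdet, one_mul]

theorem charInner_self [Finite G] {χ : G → ℂ} (h : IsIrrCharacter χ) : charInner χ χ = 1 := by
  classical
  have := Fintype.ofFinite G
  obtain ⟨n, ρ, hρ, rfl⟩ := h
  have hG : (Nat.card G : ℂ) ≠ 0 := Nat.cast_ne_zero.2 Nat.card_pos.ne'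
  let _ : Invertible (Nat.card G : ℂ) := invertibleOfNonzero hG
  have b := Representation.char_orthonormal (G := G) (k := ℂ) ρ ρ
  rw [if_pos ⟨Representation.Equiv.refl ρ⟩] at b
  rw [charInner, finsum_eq_sum_of_fintype]
  simpa only [conj_character] using b

theorem isIrreducible_comp_mulEquiv {V : Type*} [AddCommGroup V] [Module ℂ V]
    {ρ : Representation ℂ G V} (hρ : ρ.IsIrreducible) (c : G ≃* G) :
    Representation.IsIrreducible (ρ.comp c.toMonoidHom : Representation ℂ G V) := by
  let e : Subrepresentation ρ ≃o
      Subrepresentation (ρ.comp c.toMonoidHom : Representation ℂ G V) :=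
    { toFun := fun W => ⟨W.toSubmodule, fun g v hv => W.apply_mem_toSubmodule (c g) hv⟩
      invFun := fun W => ⟨W.toSubmodule, fun g v hv => by
        have := W.apply_mem_toSubmodule (c.symm g) hv
        simpa using this⟩
      left_inv := fun W => rfl
      right_inv := fun W => rfl
      map_rel_iff' := Iff.rfl }
  exact e.isSimpleOrder_iff.1 hρ

theorem nonempty_equiv_of_character_eq [Finite G] {n : ℕ}
    {ρ σ : Representation ℂ G (Fin n → ℂ)} (hρ : ρ.IsIrreducible) (hσ : σ.IsIrreducible)
    (h : ρ.character = σ.character) : Nonempty (Representation.Equiv ρ σ) := by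
  classical
  have := Fintype.ofFinite G
  have hG : (Nat.card G : ℂ) ≠ 0 := Nat.cast_ne_zero.2 Nat.card_pos.ne'
  let _ : Invertible (Nat.card G : ℂ) := invertibleOfNonzero hG
  have a := Representation.char_orthonormal (G := G) (k := ℂ) σ ρ
  have b := Representation.char_orthonormal (G := G) (k := ℂ) ρ ρ
  rw [if_pos ⟨Representation.Equiv.refl ρ⟩] at b
  rw [← h, b] at a
  by_contra hne
  rw [if_neg hne] at a
  exact one_ne_zero a

/-- Schur's lemma for automorphisms of the underlying space. -/
theorem exists_eq_smul_one_of_commute {V : Type*} [AddCommGroup V] [Module ℂ V]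
    [FiniteDimensional ℂ V] {ρ : Representation ℂ G V} (hρ : ρ.IsIrreducible)
    (T : Module.End ℂ V) (hT : ∀ g, T * ρ g = ρ g * T) : ∃ c : ℂ, T = c • 1 := by
  let f : Representation.IntertwiningMap ρ ρ := ⟨T, fun g => hT g⟩
  obtain ⟨c, hc⟩ :=
    (Representation.IsIrreducible.algebraMap_intertwiningMap_bijective_of_isAlgClosed (ρ := ρ)).2 f
  refine ⟨c, ?_⟩
  have := congrArg Representation.IntertwiningMap.toLinearMap hc
  rw [Algebra.algebraMap_eq_smul_one] at this
  exact this.symm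

end Characters

/-! ### Transfer restricted to a normal subgroup -/

section Transfer

/-- Since A is normal and inside H, `a` fixes every left coset of H, so each factor of the transfer
is μ at a conjugate of `a`. -/
theorem transfer_eq_pow_index {G C : Type*} [Group G] [CommGroup C] {H : Subgroup G}
    [H.FiniteIndex] (μ : H →* C) (A : Subgroup G) [A.Normal] (hAH : A ≤ H) (a : A)
    (hμ : ∀ g : G, μ (Subgroup.inclusion hAH (MulAut.conjNormal g a)) =
      μ (Subgroup.inclusion hAH a)) :
    μ.transfer (a : G) = μ (Subgroup.inclusion hAH a) ^ H.index := by
  classical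
  let T : H.LeftTransversal := default
  rw [MonoidHom.transfer_def μ T, Subgroup.leftTransversals.diff]
  let _ := H.fintypeQuotientOfFiniteIndex
  rw [Subgroup.index_eq_card, Nat.card_eq_fintype_card, ← Finset.card_univ]
  refine Finset.prod_eq_pow_card fun q _ => ?_
  rw [← hμ ((T.2.leftQuotientEquiv q : G)⁻¹)]
  congr 1
  ext
  have hq : ((a : G)⁻¹ • q : G ⧸ H) = q := by
    induction q using QuotientGroup.induction_on with
    | H g =>
      rw [MulAction.Quotient.smul_mk, QuotientGroup.eq]
      have := hAH ((inferInstance : A.Normal).conj_mem _ a.2 g⁻¹)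
      simpa [mul_assoc] using this
  simp only [Subgroup.coe_inclusion, MulAut.conjNormal_apply,
    Subgroup.smul_apply_eq_smul_apply_inv_smul, hq, smul_eq_mul, inv_inv, mul_assoc]

end Transfer

/-! ### Extending an invariant representation -/

section Extension

variable {G : Type*} [Group G] {N : Subgroup G} [N.Normal]
  {V : Type*} [AddCommGroup V] [Module ℂ V]

/-- The group of pairs `(g, T)` where `T` is an automorphism of the space of `ρ`, whose determinant
has order dividing `o`, that carries `ρ` to its conjugate by `g`. -/
def conjugators (ρ : Representation ℂ N V) (o : ℕ) : Subgroup (G × (Module.End ℂ V)ˣ) where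
  carrier := {x | (∀ n : N, (x.2 : Module.End ℂ V) * ρ n = ρ (MulAut.conjNormal x.1 n) * x.2) ∧
    LinearMap.det (x.2 : Module.End ℂ V) ^ o = 1}
  one_mem' := by simp
  mul_mem' := by
    rintro x y ⟨hx, hx'⟩ ⟨hy, hy'⟩
    refine ⟨fun n => ?_, ?_⟩
    · simp only [Prod.snd_mul, Prod.fst_mul, Units.val_mul, map_mul, MulAut.mul_apply]
      rw [mul_assoc, hy, ← mul_assoc, hx, mul_assoc]
    · simp only [Prod.snd_mul, Units.val_mul, map_mul, mul_pow]
      rw [hx', hy', one_mul]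
  inv_mem' := by
    rintro x ⟨hx, hx'⟩
    refine ⟨fun n => ?_, ?_⟩
    · have h := hx (MulAut.conjNormal x.1⁻¹ n)
      rw [← MulAut.mul_apply, ← map_mul, mul_inv_cancel, map_one, MulAut.one_apply] at h
      rw [Prod.snd_inv, Prod.fst_inv, Units.inv_mul_eq_iff_eq_mul, ← mul_assoc, h,
        Units.mul_inv_cancel_right]
    · have h : LinearMap.det ((x⁻¹).2 : Module.End ℂ V) *
          LinearMap.det (x.2 : Module.End ℂ V) = 1 := by
        rw [← map_mul, Prod.snd_inv, Units.inv_mul, map_one]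
      have h2 := congrArg (· ^ o) h
      simpa only [mul_pow, hx', mul_one, one_pow] using h2

/-- The embedding `n ↦ (n, ρ n)`. -/
def toConjugators (ρ : Representation ℂ N V) {o : ℕ} (ho : repDet ρ ^ o = 1) :
    N →* conjugators ρ o :=
  (N.subtype.prod (MonoidHom.toHomUnits ρ)).codRestrict _ fun n => by
    refine ⟨fun m => ?_, DFunLike.congr_fun ho n⟩
    change ρ n * ρ m = ρ (MulAut.conjNormal (n : G) m) * ρ n
    rw [← map_mul, ← map_mul]
    congr 1
    ext
    simp

theorem normal_range_toConjugators (ρ : Representation ℂ N V) {o : ℕ} (ho : repDet ρ ^ o = 1) :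
    (toConjugators ρ ho).range.Normal := by
  refine ⟨?_⟩
  rintro _ ⟨n, rfl⟩ x
  refine ⟨MulAut.conjNormal x.1.1 n, ?_⟩
  have h : (x.1.2 : Module.End ℂ V) * ρ n = ρ (MulAut.conjNormal x.1.1 n) * x.1.2 := x.2.1 n
  refine Subtype.ext (Prod.ext ?_ (Units.ext ?_))
  · exact MulAut.conjNormal_apply (x : G × (Module.End ℂ V)ˣ).1 n
  · change ρ (MulAut.conjNormal x.1.1 n) =
      ((x.1.2 * (MonoidHom.toHomUnits ρ n) * x.1.2⁻¹ : (Module.End ℂ V)ˣ) : Module.End ℂ V)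
    rw [Units.val_mul, Units.eq_mul_inv_iff_mul_eq, ← h]
    rfl

/-- The preimage in `E` of a Sylow `p`-subgroup of `E / M`. -/
theorem exists_sylow_over {E : Type*} [Group E] [Finite E] (M : Subgroup E) [M.Normal]
    {p : ℕ} [Fact p.Prime] :
    ∃ S : Subgroup E, M ≤ S ∧ ¬ p ∣ S.index ∧ ∀ x ∈ S, ∃ k : ℕ, x ^ p ^ k ∈ M := by
  let S : Sylow p (E ⧸ M) := default
  refine ⟨(S : Subgroup _).comap (QuotientGroup.mk' M), fun x hx => ?_, ?_, fun x hx => ?_⟩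
  · rw [Subgroup.mem_comap, QuotientGroup.mk'_apply, (QuotientGroup.eq_one_iff x).2 hx]
    exact one_mem _
  · rw [Subgroup.index_comap_of_surjective _ (QuotientGroup.mk'_surjective M)]
    exact S.not_dvd_index
  · obtain ⟨k, hk⟩ := S.isPGroup' ⟨_, hx⟩
    exact ⟨k, (QuotientGroup.eq_one_iff _).1 (congrArg Subtype.val hk)⟩

variable [FiniteDimensional ℂ V]

/-- The elements of `conjugators ρ o` over `1 : G` are scalars. -/
theorem exists_scalar_of_mem_conjugators {ρ : Representation ℂ N V} (hρ : ρ.IsIrreducible) {o : ℕ}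
    {x : G × (Module.End ℂ V)ˣ} (hx : x ∈ conjugators ρ o) (h1 : x.1 = 1) :
    ∃ c : ℂ, (x.2 : Module.End ℂ V) = c • 1 ∧ c ^ (Module.finrank ℂ V * o) = 1 := by
  obtain ⟨c, hc⟩ := exists_eq_smul_one_of_commute hρ (x.2 : Module.End ℂ V) fun n => by
    have := hx.1 n
    rwa [h1, map_one, MulAut.one_apply] at this
  refine ⟨c, hc, ?_⟩
  have := hx.2
  rwa [hc, LinearMap.det_smul, map_one, mul_one, ← pow_mul] at this

/-- The kernel of the projection to G embeds in a finite group of roots of unity. -/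
theorem finite_conjugators [Finite G] {ρ : Representation ℂ N V} (hρ : ρ.IsIrreducible) {o : ℕ}
    (ho : Module.finrank ℂ V * o ≠ 0) : Finite (conjugators ρ o) := by
  let f : conjugators ρ o →* G := (MonoidHom.fst _ _).comp (Subgroup.subtype _)
  have hker : Finite f.ker := by
    have hfin : Set.Finite {c : ℂ | c ^ (Module.finrank ℂ V * o) = 1} := by
      refine (Polynomial.nthRootsFinset (Module.finrank ℂ V * o) (1 : ℂ)).finite_toSet.subset
        fun c hc => ?_
      simpa [Polynomial.mem_nthRootsFinset (Nat.pos_of_ne_zero ho)] using hc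
    have := hfin.to_subtype
    choose c hc hc' using fun x : f.ker => exists_scalar_of_mem_conjugators hρ x.1.2 x.2
    refine Finite.of_injective
      (fun x => (⟨c x, hc' x⟩ : {c : ℂ | c ^ (Module.finrank ℂ V * o) = 1})) fun x y hxy => ?_
    have hxy' : c x = c y := congrArg Subtype.val hxy
    refine Subtype.ext (Subtype.ext (Prod.ext ?_ (Units.ext ?_)))
    · exact (show x.1.1.1 = 1 from x.2).trans (show y.1.1.1 = 1 from y.2).symm
    · rw [hc x, hc y, hxy']
  have : Finite (conjugators ρ o ⧸ f.ker) :=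
    Finite.of_equiv _ (QuotientGroup.quotientKerEquivRange f).symm.toEquiv
  exact Finite.of_equiv _ (Subgroup.groupEquivQuotientProdSubgroup (s := f.ker)).symm

/-- Any intertwiner can be rescaled to determinant 1. -/
theorem exists_mem_conjugators {ρ : Representation ℂ N V} {o : ℕ} (hn : Module.finrank ℂ V ≠ 0)
    (h : ∀ g : G, ∃ T : (Module.End ℂ V)ˣ,
      ∀ n : N, (T : Module.End ℂ V) * ρ n = ρ (MulAut.conjNormal g n) * T) (g : G) :
    ∃ x ∈ conjugators ρ o, x.1 = g := by
  obtain ⟨T, hT⟩ := h g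
  have hdet : LinearMap.det (T : Module.End ℂ V) ≠ 0 :=
    ((Units.map (LinearMap.det : Module.End ℂ V →* ℂ)) T).ne_zero
  obtain ⟨c, hc⟩ := IsAlgClosed.exists_pow_nat_eq (LinearMap.det (T : Module.End ℂ V))⁻¹
    (Nat.pos_of_ne_zero hn)
  have hc0 : c ≠ 0 := by
    rintro rfl
    rw [zero_pow hn] at hc
    exact inv_ne_zero hdet hc.symm
  refine ⟨(g, Units.mk0 c hc0 • T), ⟨fun n => ?_, ?_⟩, rfl⟩
  · change (c • (T : Module.End ℂ V)) * ρ n = _ * (c • (T : Module.End ℂ V))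
    rw [smul_mul_assoc, mul_smul_comm, hT]
  · change LinearMap.det (c • (T : Module.End ℂ V)) ^ o = 1
    rw [LinearMap.det_smul, hc, inv_mul_cancel₀ hdet, one_pow]

/-- An invariant irreducible representation of `N` whose degree and determinantal order are prime
to `p` extends to the full preimage of a Sylow `p`-subgroup of `G / N`. -/
theorem exists_extension_of_coprime [Finite G] {ρ : Representation ℂ N V} (hρ : ρ.IsIrreducible)
    (h : ∀ g : G, ∃ T : (Module.End ℂ V)ˣ,
      ∀ n : N, (T : Module.End ℂ V) * ρ n = ρ (MulAut.conjNormal g n) * T)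
    {p : ℕ} (hp : p.Prime) (hpd : ¬ p ∣ Module.finrank ℂ V * orderOf (repDet ρ)) :
    ∃ (H : Subgroup G) (hNH : N ≤ H) (ρ' : Representation ℂ H V), ¬ p ∣ H.index ∧
      ∀ n : N, ρ' (Subgroup.inclusion hNH n) = ρ n := by
  have : Fact p.Prime := ⟨hp⟩
  set o := orderOf (repDet ρ)
  have ho : repDet ρ ^ o = 1 := pow_orderOf_eq_one _
  have h0 : Module.finrank ℂ V * o ≠ 0 := fun h => hpd (h ▸ dvd_zero p)
  have := finite_conjugators hρ h0
  have := normal_range_toConjugators ρ ho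
  let M := (toConjugators ρ ho).range
  obtain ⟨S', hMS, hS', hpow⟩ := exists_sylow_over (p := p) M
  let f : conjugators ρ o →* G := (MonoidHom.fst _ _).comp (Subgroup.subtype _)
  have hf : Function.Surjective f := fun g => by
    obtain ⟨x, hx, hxg⟩ := exists_mem_conjugators (o := o) (left_ne_zero_of_mul h0) h g
    exact ⟨⟨x, hx⟩, hxg⟩
  have hinj : Function.Injective (f.comp S'.subtype) := by
    rw [injective_iff_map_eq_one]
    intro x hx
    obtain ⟨c, hc, hc'⟩ := exists_scalar_of_mem_conjugators hρ x.1.2 hx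
    have hxpow : (x : conjugators ρ o) ^ (Module.finrank ℂ V * o) = 1 := by
      refine Subtype.ext (Prod.ext ?_ (Units.ext ?_))
      · change x.1.1.1 ^ _ = 1
        rw [show x.1.1.1 = 1 from hx, one_pow]
      · change (x.1.1.2 : Module.End ℂ V) ^ _ = 1
        rw [hc, smul_pow, one_pow, hc', one_smul]
    obtain ⟨k, hk⟩ := hpow x x.2
    have hcop : (p ^ k).Coprime (Module.finrank ℂ V * o) :=
      Nat.Coprime.pow_left k ((Nat.Prime.coprime_iff_not_dvd hp).2 hpd)
    -- By Bézout, x is a power of x ^ p ^ k, which lies in M.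
    obtain ⟨n, hn⟩ : (x : conjugators ρ o) ∈ M := by
      have h1 := Subgroup.zpow_mem M hk (Nat.gcdA (p ^ k) (Module.finrank ℂ V * o))
      have h2 := Nat.gcd_eq_gcd_ab (p ^ k) (Module.finrank ℂ V * o)
      rw [hcop.gcd_eq_one] at h2
      rw [← zpow_one (x : conjugators ρ o), ← Nat.cast_one, h2, zpow_add, zpow_mul, zpow_mul,
        zpow_natCast, zpow_natCast, hxpow, one_zpow, mul_one]
      exact h1
    -- M meets the kernel of the projection to G trivially.
    have hn1 : n = 1 := by
      ext
      have : f (toConjugators ρ ho n) = 1 := hn ▸ hx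
      exact this
    rw [hn1, map_one] at hn
    exact Subtype.ext hn.symm
  let e := MonoidHom.ofInjective hinj
  have hmem : ∀ n : N, toConjugators ρ ho n ∈ S' := fun n => hMS ⟨n, rfl⟩
  have hNH : N ≤ (f.comp S'.subtype).range := fun n hn => ⟨⟨_, hmem ⟨n, hn⟩⟩, rfl⟩
  let r : S' →* Module.End ℂ V :=
    (Units.coeHom _).comp ((MonoidHom.snd _ _).comp ((Subgroup.subtype _).comp S'.subtype))
  refine ⟨(f.comp S'.subtype).range, hNH, r.comp e.symm.toMonoidHom, ?_, fun n => ?_⟩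
  · have h1 : (f.comp S'.subtype).range = S'.map f := by
      rw [MonoidHom.range_comp, Subgroup.range_subtype]
    rw [h1]
    exact fun hdvd => hS' (hdvd.trans (Subgroup.index_map_dvd S' hf))
  · have he : e.symm (Subgroup.inclusion hNH n) = ⟨_, hmem n⟩ := by
      exact (MulEquiv.symm_apply_eq _).2 (Subtype.ext rfl)
    change r (e.symm (Subgroup.inclusion hNH n)) = ρ n
    rw [he]
    rfl

end Extension

/-! ### Transporting the extension across the isomorphism -/

section Triples

variable {G Γ : Type*} [Group G] [Group Γ]

/-- Needed because `transport τ N` equals A only propositionally. -/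
theorem charInner_res_of_eq {A B : Subgroup Γ} (h : A = B) (hAB : A ≤ B) (ψ : B → ℂ) :
    charInner (res hAB ψ) (res hAB ψ) = charInner ψ ψ := by
  subst h
  rfl

theorem charInner_natCast_mul {G : Type*} [Finite G] (m : ℕ) (χ : G → ℂ) :
    charInner (fun g => (m : ℂ) * χ g) (fun g => (m : ℂ) * χ g) = (m : ℂ) ^ 2 * charInner χ χ := by
  have := Fintype.ofFinite G
  simp only [charInner, finsum_eq_sum_of_fintype, map_mul, Complex.conj_natCast, Finset.mul_sum]
  exact Finset.sum_congr rfl fun g _ => by ring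

variable {N : Subgroup G} [N.Normal] {A : Subgroup Γ} [A.Normal] (τ : G ⧸ N ≃* Γ ⧸ A)

theorem transport_self : transport τ N = A := by
  rw [transport, quot, (QuotientGroup.map_mk'_self N : N.map _ = ⊥), Subgroup.map_bot,
    MonoidHom.comap_bot, QuotientGroup.ker_mk']

theorem index_transport {H : Subgroup G} (hNH : N ≤ H) : (transport τ H).index = H.index := by
  rw [transport, Subgroup.index_comap_of_surjective _ (QuotientGroup.mk'_surjective A)]
  refine (Subgroup.index_map_equiv _ τ).trans ?_
  refine Subgroup.index_map_eq _ (QuotientGroup.mk'_surjective N) ?_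
  rwa [QuotientGroup.ker_mk']

/-- An invariant irreducible representation is conjugate to each of its translates. -/
theorem exists_conjugating_unit [Finite G] {n : ℕ} {ρ : Representation ℂ N (Fin n → ℂ)}
    (hρ : ρ.IsIrreducible) (h : IsCharTriple N ρ.character) (g : G) :
    ∃ T : (Module.End ℂ (Fin n → ℂ))ˣ,
      ∀ x : N, (T : Module.End ℂ (Fin n → ℂ)) * ρ x = ρ (MulAut.conjNormal g x) * T := by
  obtain ⟨e⟩ := nonempty_equiv_of_character_eq hρ
    (isIrreducible_comp_mulEquiv hρ (MulAut.conjNormal g))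
    (funext fun x => (h.invariant g x).symm)
  refine ⟨LinearMap.GeneralLinearGroup.ofLinearEquiv e.toLinearEquiv, fun x => ?_⟩
  refine LinearMap.ext fun v => ?_
  exact e.toIntertwiningMap.isIntertwining _ _ x v

/-- Isomorphisms of character triples map extensions of `φ` to extensions of `lam`. -/
theorem IsCharTripleIso.res_map_eq [Finite G] [Finite Γ] {φ : N → ℂ} {lam : A → ℂ}
    (hφ : IsIrrCharacter φ) (hlam : IsIrrCharacter lam)
    {σ : ∀ H : Subgroup G, (H → ℂ) → (transport τ H → ℂ)} (hσ : IsCharTripleIso φ lam τ σ)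
    {H : Subgroup G} (hNH : N ≤ H) {χ : H → ℂ} (hχ : IsCharacter χ) (hres : res hNH χ = φ) :
    res (le_transport τ H) (σ H χ) = lam := by
  have hχ' : χ ∈ charsOver hNH φ := ⟨hχ, 1, by simp [hres]⟩
  have hφ' : φ ∈ charsOver le_rfl φ := by
    obtain ⟨n, ρ, hn, hρ⟩ := hχ
    refine ⟨⟨n, ρ.comp (Subgroup.inclusion hNH), hn, ?_⟩, 1, by simp only [Nat.cast_one, one_mul]; rfl⟩
    rw [← hres, ← hρ]
    rfl
  obtain ⟨m, hm⟩ := (hσ.mapsTo N le_rfl hφ').2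
  -- The image of φ restricts to mλ, of norm m²; the isometry forces this to be [φ, φ] = 1.
  have h1 : (m : ℂ) ^ 2 = 1 := by
    have h2 := hσ.map_inner N le_rfl φ hφ' φ hφ'
    rw [charInner_self hφ, ← charInner_res_of_eq (transport_self τ).symm (le_transport τ N), hm,
      charInner_natCast_mul, charInner_self hlam, mul_one] at h2
    exact h2
  have hm1 : m = 1 := by
    have : m ^ 2 = 1 := by exact_mod_cast h1
    simpa using this
  have h3 := hσ.map_res H N le_rfl hNH χ hχ'
  rw [hres] at h3
  rw [h3, hm1, Nat.cast_one] at hm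
  exact hm.trans (funext fun a => one_mul _)

theorem repDet_eq_character_of_character_one {n : ℕ} (ρ : Representation ℂ G (Fin n → ℂ))
    (h : ρ.character 1 = 1) (g : G) : repDet ρ g = ρ.character g := by
  have hn : n = 1 := by
    rw [Representation.char_one, Module.finrank_fin_fun] at h
    exact_mod_cast h
  subst hn
  change LinearMap.det (ρ g) = LinearMap.trace ℂ _ (ρ g)
  rw [← LinearMap.det_toMatrix', ← Matrix.toLin'_toMatrix' (ρ g), Matrix.trace_toLin'_eq]
  simp [Matrix.trace]

end Triples

end CharTriple

theorem proposition2p1 {G Γ : Type*} [Group G] [Finite G] [Group Γ] [Finite Γ]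
    (N : Subgroup G) [N.Normal] (φ : N → ℂ) (A : Subgroup Γ) [A.Normal] (lam : A → ℂ)
    (hG : CharTriple.IsCharTriple N φ) (hΓ : CharTriple.IsCharTriple A lam)
    (hiso : CharTriple.CharTripleIsomorphic φ lam)
    (hA : A ≤ commutator Γ) (hlin : lam 1 = 1)
    (p : ℕ) (hp : p.Prime) (hdvd : p ∣ CharTriple.detOrder lam) :
    ∃ d : ℕ, φ 1 = (d : ℂ) ∧ p ∣ d * CharTriple.detOrder φ := by
  open CharTriple in
  obtain ⟨d, ρ, hρ, rfl⟩ := hG.irr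
  refine ⟨d, by rw [Representation.char_one, Module.finrank_fin_fun], ?_⟩
  rw [detOrder, irrDet_eq_repDet ρ hρ]
  by_contra hpd
  obtain ⟨H, hNH, ρ', hH, hext⟩ := exists_extension_of_coprime hρ
    (exists_conjugating_unit hρ hG) hp (by rwa [Module.finrank_fin_fun])
  obtain ⟨τ, σ, hσ⟩ := hiso
  have hd : d ≠ 0 := by
    rintro rfl
    simp at hpd
  have hres : res hNH ρ'.character = ρ.character :=
    funext fun x => congrArg (LinearMap.trace ℂ _) (hext x)
  have hχ : IsCharacter ρ'.character := ⟨d, ρ', hd, rfl⟩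
  have hlam := IsCharTripleIso.res_map_eq τ ⟨d, ρ, hρ, rfl⟩ hΓ.irr hσ hNH hχ hres
  obtain ⟨⟨k, μ, -, hμ⟩, -⟩ :=
    hσ.mapsTo H hNH ⟨hχ, 1, by simp [hres]⟩
  rw [← hμ] at hlam
  have hμ1 : μ.character 1 = 1 := by
    rw [← hlin, ← hlam]
    simp [res]
  -- μ has degree 1, so its determinant is μ itself, now as a homomorphism to an abelian group.
  let ν := (repDet μ).toHomUnits
  have hν : ∀ a : A, (ν (Subgroup.inclusion (le_transport τ H) a) : ℂ) = lam a := fun a => by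
    rw [← hlam]
    exact repDet_eq_character_of_character_one μ hμ1 _
  have hpow : ∀ a : A, lam a ^ H.index = 1 := fun a => by
    have h1 := transfer_eq_pow_index ν A (le_transport τ H) a fun g => by
      ext
      rw [hν, hν, hΓ.invariant]
    have h2 : ν.transfer (a : Γ) = 1 := Abelianization.commutator_subset_ker _ (hA a.2)
    rw [h2, index_transport τ hNH] at h1
    rw [← hν a, ← Units.val_pow_eq_pow_val, ← h1, Units.val_one]
  refine hH (hdvd.trans ?_)
  obtain ⟨l, ρl, hρl, rfl⟩ := hΓ.irr
  rw [detOrder, irrDet_eq_repDet ρl hρl]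
  refine orderOf_dvd_of_pow_eq_one (MonoidHom.ext fun a => ?_)
  rw [MonoidHom.pow_apply, repDet_eq_character_of_character_one ρl hlin, hpow a, MonoidHom.one_apply]
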